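/- Let $n,m$ be non-negative integers and let $A\in\mathbb{C}^{n\times n}$, $B\in\mathbb{C}^{n\times m}$ be such that the pair $(A,B)$ is controllable, i.e. the matrix $[\lambda I_n-A,\ B]$ is right invertible for every $\lambda\in\mathbb{C}$. Let $Q=Q'\in\mathbb{C}^{(n+m)\times(n+m)}$, where $'$ denotes the Hermitian conjugate, and let $\sigma:\mathbb{C}^n\times\mathbb{C}^m\to\mathbb{R}$ be the Hermitian form $$\sigma(x,u)=\begin{bmatrix}x\\u\end{bmatrix}'Q\begin{bmatrix}x\\u\end{bmatrix}.$$ Then the following conditions are equivalent: (a) there exists $P=P'\in\mathbb{C}^{n\times n}$ such that the Hermitian form $\sigma_P:\mathbb{C}^n\times\mathbb{C}^m\to\mathbb{R}$ defined by $$\sigma_P(x,u)=\sigma(x,u)+x'Px-(Ax+Bu)'P(Ax+Bu)$$ is positive semidefinite, i.e. $\sigma_P(x,u)\ge0$ for all $x\in\mathbb{C}^n$, $u\in\mathbb{C}^m$; (b) for every $z\in\mathbb{C}$ with $|z|=1$, the form $\sigma$ is positive semidefinite on the subspace $$\mathcal{L}(z)=\{(x,u)\in\mathbb{C}^n\times\mathbb{C}^m:\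 zx=Ax+Bu\}.$$ Moreover, if (b) holds and the matrices $A$, $B$, $Q$ are real, then the matrix $P$ in (a) can be chosen to be real as well. -/

import Mathlib

open Matrix

namespace KYP

/-- The pair `(A, B)` is controllable: the block matrix `[λ I - A, B]` is right invertible
for every complex number `λ`. -/
def Controllable {n m : ℕ} (A : Matrix (Fin n) (Fin n) ℂ) (B : Matrix (Fin n) (Fin m) ℂ) : Prop :=
  ∀ l : ℂ, ∃ M : Matrix (Fin n ⊕ Fin m) (Fin n) ℂ,
    Matrix.fromCols (l • (1 : Matrix (Fin n) (Fin n) ℂ) - A) B * M = 1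

/-- The value `v' M v`, as a real number. For Hermitian `M` the complex number `v' M v` is real,
see `coe_hermForm`. -/
def hermForm {ι : Type*} [Fintype ι] (M : Matrix ι ι ℂ) (v : ι → ℂ) : ℝ :=
  (star v ⬝ᵥ (M *ᵥ v)).re

/-- For a Hermitian matrix, taking the real part in `hermForm` loses nothing. -/
theorem coe_hermForm {ι : Type*} [Fintype ι] {M : Matrix ι ι ℂ} (hM : M.IsHermitian)
    (v : ι → ℂ) : (hermForm M v : ℂ) = star v ⬝ᵥ (M *ᵥ v) := by
  apply Complex.ext
  · simp [hermForm]
  · have h := hM.im_star_dotProduct_mulVec_self v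
    simpa using h.symm

/-- The Hermitian form `σ(x, u) = [x; u]' Q [x; u]` on `ℂⁿ × ℂᵐ`. -/
def sigma {n m : ℕ} (Q : Matrix (Fin n ⊕ Fin m) (Fin n ⊕ Fin m) ℂ)
    (x : Fin n → ℂ) (u : Fin m → ℂ) : ℝ :=
  hermForm Q (Sum.elim x u)

/-- The Hermitian form `σ_P(x, u) = σ(x, u) + x' P x - (A x + B u)' P (A x + B u)`. -/
def sigmaP {n m : ℕ} (A : Matrix (Fin n) (Fin n) ℂ) (B : Matrix (Fin n) (Fin m) ℂ)
    (Q : Matrix (Fin n ⊕ Fin m) (Fin n ⊕ Fin m) ℂ) (P : Matrix (Fin n) (Fin n) ℂ)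
    (x : Fin n → ℂ) (u : Fin m → ℂ) : ℝ :=
  sigma Q x u + hermForm P x - hermForm P (A *ᵥ x + B *ᵥ u)

/-- The subspace `L(z) = {(x, u) : z x = A x + B u}` of `ℂⁿ × ℂᵐ`. -/
def subspaceL {n m : ℕ} (A : Matrix (Fin n) (Fin n) ℂ) (B : Matrix (Fin n) (Fin m) ℂ) (z : ℂ) :
    Submodule ℂ ((Fin n → ℂ) × (Fin m → ℂ)) where
  carrier := {p | z • p.1 = A *ᵥ p.1 + B *ᵥ p.2}
  zero_mem' := by simp
  add_mem' := by
    intro p q hp hq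
    simp only [Set.mem_setOf_eq, Prod.fst_add, Prod.snd_add, smul_add, mulVec_add] at hp hq ⊢
    rw [hp, hq]
    abel
  smul_mem' := by
    intro c p hp
    simp only [Set.mem_setOf_eq, Prod.smul_fst, Prod.smul_snd, mulVec_smul] at hp ⊢
    rw [smul_comm, hp, smul_add]

/-- All entries of the complex matrix `M` are real numbers. -/
def IsRealMatrix {ι κ : Type*} (M : Matrix ι κ ℂ) : Prop :=
  ∀ i j, (M i j).im = 0

end KYP

/-! Write `E = [1, 0]` and `G = [A, B]`. On `L(z)` with `|z| = 1` the two storage terms cancel, so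
(a) gives (b). The converse is a duality argument. The matrices admitting a storage `P` form a
convex cone (`dissipative`). If `Q` were outside it and the cone closed, a functional `M ↦ Re tr(W
M)` would be nonnegative on the cone and negative at `Q`. Testing it on suitable members shows that
`W` is positive semidefinite and `E W E' = G W G'`. Such a `W` is a sum of dyads `v v'` with `G v =
z E v`, `|z| = 1` (`exists_sum_dyads`), so (b) makes the value at `Q` nonnegative, a contradiction.

Closedness (`isClosed_dissipative`) is where controllability enters: a Hermitian form nonincreasing
along all trajectories must vanish (`form_eq_zero_of_antitone`). For real data, `P` is averaged with
its entrywise conjugate. -/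

namespace KYP

/-! ### Diagonalization and extension of isometries -/

section Isometry

open Module.End

variable {E : Type*} [NormedAddCommGroup E] [InnerProductSpace ℂ E] [FiniteDimensional ℂ E]

omit [FiniteDimensional ℂ E] in
theorem norm_eq_one_of_isometry_eigenvector (T : E →ₗᵢ[ℂ] E) {a : ℂ} {x : E} (hx : x ≠ 0)
    (h : T x = a • x) : ‖a‖ = 1 := by
  have h1 : ‖x‖ = ‖a‖ * ‖x‖ := by rw [← norm_smul, ← h, T.norm_map]
  have h2 : ‖x‖ ≠ 0 := norm_ne_zero_iff.mpr hx
  field_simp at h1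
  exact h1.symm

omit [FiniteDimensional ℂ E] in
theorem orthogonalFamily_eigenspaces_of_isometry (T : E →ₗᵢ[ℂ] E) :
    OrthogonalFamily ℂ (fun a : ℂ => eigenspace T.toLinearMap a)
      fun a => (eigenspace T.toLinearMap a).subtypeₗᵢ := by
  refine OrthogonalFamily.of_pairwise fun a b hab x hx y hy => ?_
  rw [mem_eigenspace_iff] at hx hy
  by_contra hne
  have hy0 : x ≠ 0 := by rintro rfl; simp at hne
  have ha := norm_eq_one_of_isometry_eigenvector T hy0 hx
  have h1 := T.inner_map_map y x
  rw [show T y = b • y from hy, show T x = a • x from hx, inner_smul_left, inner_smul_right,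
    ← mul_assoc] at h1
  have h2 : (starRingEnd ℂ) b * a = 1 := by
    have := mul_right_cancel₀ hne (h1.trans (one_mul _).symm)
    exact this
  have hb : (starRingEnd ℂ) a * a = 1 := by
    rw [mul_comm, Complex.mul_conj, Complex.normSq_eq_norm_sq, ha]; simp
  have ha0 : a ≠ 0 := by rintro rfl; simp at ha
  have h3 := mul_right_cancel₀ ha0 (hb.trans h2.symm)
  exact hab ((starRingEnd ℂ).injective h3)

/-- The complement is `T`-invariant because `T` preserves inner products; if nonzero, it would
contain an eigenvector, orthogonal to itself. -/
theorem isometry_orthogonal_iSup_eigenspaces (T : E →ₗᵢ[ℂ] E) :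
    (⨆ a : ℂ, eigenspace T.toLinearMap a)ᗮ = ⊥ := by
  set S : Submodule ℂ E := (⨆ a : ℂ, eigenspace T.toLinearMap a)ᗮ with hS
  have hinv : ∀ x ∈ S, T.toLinearMap x ∈ S := by
    rw [hS, ← Submodule.iInf_orthogonal]
    intro x hx
    simp only [Submodule.mem_iInf, Submodule.mem_orthogonal] at hx ⊢
    intro a y hy
    have h := T.inner_map_map y x
    rw [hx a y hy, show T y = a • y from mem_eigenspace_iff.mp hy, inner_smul_left] at h
    rcases mul_eq_zero.mp h with h | h
    · have ha : a = 0 := by simpa using h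
      have : y = 0 := by
        apply T.injective
        rw [show T y = a • y from mem_eigenspace_iff.mp hy, ha, zero_smul, map_zero]
      simp [this]
    · exact h
  by_contra hne
  have : Nontrivial S := Submodule.nontrivial_iff_ne_bot.mpr hne
  obtain ⟨a, ha⟩ := Module.End.exists_eigenvalue (T.toLinearMap.restrict hinv)
  obtain ⟨x, hx⟩ := ha.exists_hasEigenvector
  have h1 : T.toLinearMap (x : E) = a • (x : E) := congrArg Subtype.val hx.apply_eq_smul
  have h2 : (x : E) ∈ ⨆ a : ℂ, eigenspace T.toLinearMap a :=
    (le_iSup (fun a : ℂ => eigenspace T.toLinearMap a) a) (mem_eigenspace_iff.mpr h1)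
  have h3 : inner ℂ (x : E) (x : E) = 0 := x.2 x h2
  exact hx.2 (Subtype.ext (inner_self_eq_zero.mp h3))

theorem exists_orthonormalBasis_eigenvectors_of_isometry (T : E →ₗᵢ[ℂ] E) :
    ∃ (b : OrthonormalBasis (Fin (Module.finrank ℂ E)) ℂ E)
      (d : Fin (Module.finrank ℂ E) → ℂ), ∀ i, ‖d i‖ = 1 ∧ T (b i) = d i • b i := by
  classical
  have horth : OrthogonalFamily ℂ (fun a : Eigenvalues T.toLinearMap =>
      eigenspace T.toLinearMap a) fun a => (eigenspace T.toLinearMap a).subtypeₗᵢ :=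
    (orthogonalFamily_eigenspaces_of_isometry T).comp Subtype.coe_injective
  have hint : DirectSum.IsInternal fun a : Eigenvalues T.toLinearMap =>
      eigenspace T.toLinearMap a := by
    refine horth.isInternal_iff.mpr ?_
    change (⨆ a : { a // eigenspace T.toLinearMap a ≠ ⊥ }, eigenspace T.toLinearMap a)ᗮ = ⊥
    rw [iSup_ne_bot_subtype, isometry_orthogonal_iSup_eigenspaces]
  let b := hint.subordinateOrthonormalBasis rfl horth
  refine ⟨b, fun i => (hint.subordinateOrthonormalBasisIndex rfl i horth).val, fun i => ?_⟩
  have h := mem_eigenspace_iff.mp (hint.subordinateOrthonormalBasis_subordinate rfl i horth)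
  have hb : b i ≠ 0 := b.orthonormal.ne_zero i
  exact ⟨norm_eq_one_of_isometry_eigenvector T hb h, h⟩

/-- Two linear maps with the same Gram form differ by a linear isometry of the codomain. -/
theorem exists_isometry_of_norm_eq {F : Type*} [AddCommGroup F] [Module ℂ F]
    (f g : F →ₗ[ℂ] E) (h : ∀ x, ‖f x‖ = ‖g x‖) : ∃ T : E →ₗᵢ[ℂ] E, ∀ x, T (f x) = g x := by
  have hker : LinearMap.ker f.rangeRestrict ≤ LinearMap.ker g := by
    intro x hx
    rw [LinearMap.ker_rangeRestrict, LinearMap.mem_ker] at hx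
    rw [LinearMap.mem_ker, ← norm_eq_zero, ← h, hx, norm_zero]
  obtain ⟨L, hL⟩ : ∃ L : LinearMap.range f →ₗ[ℂ] E, ∀ x, L (f.rangeRestrict x) = g x := by
    obtain ⟨r, hr⟩ := f.rangeRestrict.exists_rightInverse_of_surjective f.range_rangeRestrict
    refine ⟨g ∘ₗ r, fun x => ?_⟩
    have h1 : r (f.rangeRestrict x) - x ∈ LinearMap.ker f.rangeRestrict := by
      rw [LinearMap.mem_ker, map_sub, sub_eq_zero]
      exact LinearMap.congr_fun hr _
    have h2 := hker h1
    rw [LinearMap.mem_ker, map_sub, sub_eq_zero] at h2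
    exact h2
  let T : LinearMap.range f →ₗᵢ[ℂ] E := ⟨L, by
    rintro ⟨_, x, rfl⟩
    exact (congrArg norm (hL x)).trans (h x).symm⟩
  exact ⟨T.extend, fun x => (T.extend_apply (f.rangeRestrict x)).trans (hL x)⟩

end Isometry

/-! ### Controllability and monotone forms -/

section Submodules

variable {V U : Type*} [AddCommGroup V] [Module ℂ V] [FiniteDimensional ℂ V]
  [AddCommGroup U] [Module ℂ U]

/-- For a controllable pair, an invariant subspace containing the range of the input map is
the whole space. -/
theorem eq_top_of_invariant (a : V →ₗ[ℂ] V) (b : U →ₗ[ℂ] V)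
    (hab : ∀ (l : ℂ) (y : V), ∃ x u, l • x - a x + b u = y) (S : Submodule ℂ V)
    (hb : LinearMap.range b ≤ S) (ha : S ≤ S.comap a) : S = ⊤ := by
  by_contra hne
  have : Nontrivial (V ⧸ S) := Submodule.Quotient.nontrivial_iff.mpr hne
  obtain ⟨l, hl⟩ := Module.End.exists_eigenvalue (S.mapQ S a ha)
  obtain ⟨v, hv⟩ := hl.exists_hasEigenvector
  -- Modulo `S` the input term disappears, so controllability makes `g` surjective, hence injective;
  -- yet `g` kills the eigenvector `v`.
  let g : V ⧸ S →ₗ[ℂ] V ⧸ S := l • LinearMap.id - S.mapQ S a ha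
  have hsurj : Function.Surjective g := by
    intro y
    obtain ⟨y, rfl⟩ := S.mkQ_surjective y
    obtain ⟨x, u, rfl⟩ := hab l y
    refine ⟨S.mkQ x, ?_⟩
    have hu : S.mkQ (b u) = 0 := by simpa using hb ⟨u, rfl⟩
    simp only [map_add, hu, map_sub, map_smul]
    simp [g]
  have hinj := LinearMap.injective_iff_surjective.mpr hsurj
  apply hv.2
  apply hinj
  have := hv.apply_eq_smul
  simp [g, this]

/-- `a` induces an injection of `V ⧸ T.comap a` into `V ⧸ T`. No invertibility of `a` is needed. -/
theorem finrank_le_finrank_comap (a : V →ₗ[ℂ] V) (T : Submodule ℂ V) :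
    Module.finrank ℂ T ≤ Module.finrank ℂ (T.comap a) := by
  have hinj : Function.Injective ((T.comap a).mapQ T a le_rfl) := by
    rw [← LinearMap.ker_eq_bot, Submodule.ker_mapQ, Submodule.mkQ_map_self]
  have h1 := LinearMap.finrank_le_finrank_of_injective hinj
  have h2 := T.finrank_quotient_add_finrank
  have h3 := (T.comap a).finrank_quotient_add_finrank
  omega

/-- A form that does not increase along the trajectories of a controllable system vanishes. -/
theorem form_eq_zero_of_antitone (a : V →ₗ[ℂ] V) (b : U →ₗ[ℂ] V)
    (hab : ∀ (l : ℂ) (y : V), ∃ x u, l • x - a x + b u = y) (φ : V → ℝ) (h0 : φ 0 = 0)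
    (hφ : ∀ x u, φ (a x + b u) ≤ φ x) (x : V) : φ x = 0 := by
  have stable : ∀ F : Submodule ℂ V → Submodule ℂ V, Monotone F → ∃ n, F^[n + 1] ⊥ = F^[n] ⊥ := by
    intro F hF
    obtain ⟨n, hn⟩ := monotone_stabilizes_iff_noetherian.mpr (inferInstance : IsNoetherian ℂ V)
      ⟨fun n => F^[n] ⊥, hF.monotone_iterate_of_le_map bot_le⟩
    exact ⟨n, (hn (n + 1) (Nat.le_succ n)).symm⟩
  apply le_antisymm
  -- The iterates are the states reachable from `0`, where `φ ≤ 0`.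
  · let F : Submodule ℂ V → Submodule ℂ V := fun S => S.map a ⊔ LinearMap.range b
    have hF : Monotone F := fun S T h => sup_le_sup_right (Submodule.map_mono h) _
    have key : ∀ n, ∀ x ∈ F^[n] ⊥, φ x ≤ 0 := by
      intro n
      induction n with
      | zero => intro x hx; rw [Function.iterate_zero, id, Submodule.mem_bot] at hx; rw [hx, h0]
      | succ n ih =>
        intro x hx
        rw [Function.iterate_succ_apply'] at hx
        obtain ⟨_, ⟨y, hy, rfl⟩, _, ⟨u, rfl⟩, rfl⟩ := Submodule.mem_sup.mp hx
        exact (hφ y u).trans (ih y hy)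
    obtain ⟨n, hn⟩ := stable F hF
    rw [Function.iterate_succ_apply'] at hn
    have htop : F^[n] ⊥ = ⊤ := by
      refine eq_top_of_invariant a b hab _ ?_ ?_
      · exact le_sup_right.trans hn.le
      · exact Submodule.map_le_iff_le_comap.mp (le_sup_left.trans hn.le)
    exact key n x (htop ▸ Submodule.mem_top)
  -- The iterates are the states that can be steered to `0`, where `φ ≥ 0`.
  · let F : Submodule ℂ V → Submodule ℂ V := fun S => (S ⊔ LinearMap.range b).comap a
    have hF : Monotone F := fun S T h => Submodule.comap_mono (sup_le_sup_right h _)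
    have key : ∀ n, ∀ x ∈ F^[n] ⊥, 0 ≤ φ x := by
      intro n
      induction n with
      | zero => intro x hx; rw [Function.iterate_zero, id, Submodule.mem_bot] at hx; rw [hx, h0]
      | succ n ih =>
        intro x hx
        rw [Function.iterate_succ_apply'] at hx
        obtain ⟨y, hy, _, ⟨u, rfl⟩, hyu⟩ := Submodule.mem_sup.mp (Submodule.mem_comap.mp hx)
        have h1 : y = a x + b (-u) := by rw [map_neg, ← hyu]; abel
        exact (ih y hy).trans (h1 ▸ hφ x (-u))
    obtain ⟨n, hn⟩ := stable F hF
    rw [Function.iterate_succ_apply'] at hn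
    set S := F^[n] ⊥
    have hdim := finrank_le_finrank_comap a (S ⊔ LinearMap.range b)
    -- At the fixed point, `S` is the preimage of `S ⊔ range b`, so its dimension is no smaller.
    have hS : S = S ⊔ LinearMap.range b := by
      refine Submodule.eq_of_le_of_finrank_le le_sup_left (hdim.trans ?_)
      exact (congrArg (fun T : Submodule ℂ V => Module.finrank ℂ T) hn).le
    have htop : S = ⊤ := by
      refine eq_top_of_invariant a b hab _ (hS ▸ le_sup_right) ?_
      have : S.comap a = S := by
        conv_lhs => rw [hS]
        exact hn
      exact this.ge
    exact key n x (htop.ge Submodule.mem_top)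

end Submodules

end KYP

open scoped ComplexOrder

/-! ### Hermitian forms and dyadic decompositions -/

namespace KYP

variable {ι ν : Type*} [Fintype ι] [Fintype ν]

theorem hermForm_eq_trace (M : Matrix ι ι ℂ) (v : ι → ℂ) :
    hermForm M v = (M * vecMulVec v (star v)).trace.re := by
  rw [hermForm, mul_vecMulVec, trace_vecMulVec, dotProduct_comm]

theorem hermForm_conjTranspose_mul_mul (P : Matrix ν ν ℂ) (E : Matrix ν ι ℂ) (v : ι → ℂ) :
    hermForm (Eᴴ * P * E) v = hermForm P (E *ᵥ v) := by
  simp only [hermForm, star_mulVec, ← mulVec_mulVec, dotProduct_mulVec, vecMul_vecMul]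

theorem hermForm_add (M N : Matrix ι ι ℂ) (v : ι → ℂ) :
    hermForm (M + N) v = hermForm M v + hermForm N v := by
  simp [hermForm, add_mulVec, dotProduct_add]

theorem hermForm_smul (t : ℝ) (M : Matrix ι ι ℂ) (v : ι → ℂ) :
    hermForm (t • M) v = t * hermForm M v := by
  simp [hermForm, smul_mulVec, dotProduct_smul]

theorem hermForm_neg (M : Matrix ι ι ℂ) (v : ι → ℂ) : hermForm (-M) v = -hermForm M v := by
  simp [hermForm, neg_mulVec, dotProduct_neg]

theorem hermForm_sub (M N : Matrix ι ι ℂ) (v : ι → ℂ) :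
    hermForm (M - N) v = hermForm M v - hermForm N v := by
  rw [sub_eq_add_neg, hermForm_add, hermForm_neg, sub_eq_add_neg]

theorem hermForm_conjTranspose (M : Matrix ι ι ℂ) (v : ι → ℂ) :
    hermForm Mᴴ v = hermForm M v := by
  have h : star v ⬝ᵥ (Mᴴ *ᵥ v) = star (star v ⬝ᵥ (M *ᵥ v)) := by
    rw [star_dotProduct, star_mulVec, conjTranspose_conjTranspose, ← dotProduct_mulVec]
  rw [hermForm, h]
  simp [hermForm]

theorem hermForm_smul_vec (M : Matrix ι ι ℂ) (z : ℂ) (v : ι → ℂ) :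
    hermForm M (z • v) = ‖z‖ ^ 2 * hermForm M v := by
  have h : star (z • v) ⬝ᵥ (M *ᵥ (z • v)) = ((‖z‖ ^ 2 : ℝ) : ℂ) * (star v ⬝ᵥ (M *ᵥ v)) := by
    rw [mulVec_smul, star_smul, smul_dotProduct, dotProduct_smul, smul_smul, smul_eq_mul,
      ← Complex.normSq_eq_norm_sq, ← Complex.mul_conj, mul_comm z]
    rfl
  rw [hermForm, h, Complex.re_ofReal_mul]
  rfl

theorem continuous_hermForm (v : ι → ℂ) : Continuous fun M : Matrix ι ι ℂ => hermForm M v := by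
  unfold hermForm
  fun_prop

theorem eq_zero_of_hermForm_eq_zero {P : Matrix ι ι ℂ} (hP : P.IsHermitian)
    (h : ∀ v, hermForm P v = 0) : P = 0 := by
  classical
  have h0 : ∀ v, star v ⬝ᵥ (P *ᵥ v) = 0 := fun v => by
    rw [← coe_hermForm hP, h, Complex.ofReal_zero]
  have hpsd : P.PosSemidef := .of_dotProduct_mulVec_nonneg hP fun v => (h0 v).ge
  ext i j
  have := congrFun ((hpsd.dotProduct_mulVec_zero_iff _).mp (h0 (Pi.single j 1))) i
  simpa using this

open scoped MatrixOrder in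
theorem exists_eq_mul_conjTranspose {W : Matrix ι ι ℂ} (hW : W.PosSemidef) :
    ∃ V : Matrix ι ι ℂ, W = V * Vᴴ := by
  classical
  obtain ⟨B, rfl⟩ := CStarAlgebra.nonneg_iff_eq_star_mul_self.mp hW.nonneg
  exact ⟨Bᴴ, by rw [conjTranspose_conjTranspose]; rfl⟩

theorem inner_toLp_conjTranspose_mulVec (M : Matrix ν ι ℂ) (w : ν → ℂ) (x : EuclideanSpace ℂ ι) :
    inner ℂ (WithLp.toLp 2 (Mᴴ *ᵥ w)) x = star w ⬝ᵥ (M *ᵥ x.ofLp) := by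
  rw [EuclideanSpace.inner_eq_star_dotProduct, star_mulVec, conjTranspose_conjTranspose,
    dotProduct_comm, dotProduct_mulVec]

/-- A positive semidefinite matrix `W` with `E W E' = G W G'` is a sum of dyads `v v'` such that
`G v` is a unimodular multiple of `E v`. -/
theorem exists_sum_dyads (E G : Matrix ν ι ℂ) {W : Matrix ι ι ℂ} (hW : W.PosSemidef)
    (hEG : E * W * Eᴴ = G * W * Gᴴ) :
    ∃ (N : ℕ) (v : Fin N → ι → ℂ), W = ∑ k, vecMulVec (v k) (star (v k)) ∧
      ∀ k, ∃ z : ℂ, ‖z‖ = 1 ∧ G *ᵥ v k = z • (E *ᵥ v k) := by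
  classical
  obtain ⟨V, rfl⟩ := exists_eq_mul_conjTranspose hW
  let lin : Matrix ν ι ℂ → (ν → ℂ) →ₗ[ℂ] EuclideanSpace ℂ ι := fun M =>
    (WithLp.linearEquiv 2 ℂ (ι → ℂ)).symm.toLinearMap ∘ₗ Mᴴ.mulVecLin
  have hlin : ∀ M w x, inner ℂ (lin M w) x = star w ⬝ᵥ (M *ᵥ x.ofLp) :=
    inner_toLp_conjTranspose_mulVec
  have hnorm : ∀ M w, (‖lin M w‖ ^ 2 : ℝ) = (star w ⬝ᵥ ((M * Mᴴ) *ᵥ w)).re := by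
    intro M w
    rw [← inner_self_eq_norm_sq (𝕜 := ℂ), hlin, ← mulVec_mulVec]
    rfl
  -- With `W = V V'`, the hypothesis says that `(E V)' w` and `(G V)' w` have equal norms, so an
  -- isometry `T` carries one to the other. The dyads come from `V` applied to an eigenbasis of `T`.
  obtain ⟨T, hT⟩ := exists_isometry_of_norm_eq (lin (E * V)) (lin (G * V)) (fun w => by
    have h1 : E * V * (E * V)ᴴ = G * V * (G * V)ᴴ := by
      simpa only [conjTranspose_mul, Matrix.mul_assoc] using hEG
    rw [← sq_eq_sq₀ (norm_nonneg _) (norm_nonneg _), hnorm, hnorm, h1])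
  obtain ⟨b, d, hb⟩ := exists_orthonormalBasis_eigenvectors_of_isometry T
  refine ⟨_, fun k => V *ᵥ (b k).ofLp, ?_, fun k => ⟨(d k)⁻¹, ?_, ?_⟩⟩
  · ext i j
    let r : ι → EuclideanSpace ℂ ι := fun i => WithLp.toLp 2 (Vᴴ *ᵥ Pi.single i 1)
    have hr : ∀ i x, inner ℂ (r i) x = (V *ᵥ x.ofLp) i := fun i x => by
      rw [inner_toLp_conjTranspose_mulVec, ← Pi.single_star, star_one, single_one_dotProduct]
    have h := b.sum_inner_mul_inner (r i) (r j)
    simp only [hr, ← inner_conj_symm (b _) (r j)] at h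
    rw [Matrix.sum_apply]
    simp only [vecMulVec_apply, Pi.star_apply]
    refine Eq.trans ?_ h.symm
    simp only [r, mulVec_single_one]
    rfl
  · rw [norm_inv, (hb k).1, inv_one]
  · have hd : d k ≠ 0 := by
      intro h
      have := (hb k).1
      simp [h] at this
    rw [eq_inv_smul_iff₀ hd]
    refine dotProduct_eq _ _ fun w => ?_
    have h := T.inner_map_map (lin (E * V) (star w)) (b k)
    rw [hT, (hb k).2, inner_smul_right, hlin, hlin, star_star] at h
    rw [dotProduct_comm, dotProduct_smul, dotProduct_comm _ w, mulVec_mulVec, mulVec_mulVec,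
      smul_eq_mul]
    exact h

/-! ### The cone of dissipative forms and its separation from a point -/

section Separation

attribute [local instance] Matrix.normedAddCommGroup Matrix.normedSpace

/-- The real part of the trace pairing represents every real linear functional on complex
matrices. -/
theorem exists_re_trace_mul_eq (f : Matrix ι ι ℂ →ₗ[ℝ] ℝ) :
    ∃ W : Matrix ι ι ℂ, ∀ M, f M = (W * M).trace.re := by
  classical
  -- Chosen so that `Re((p - q i) c) = p Re c + q Im c`; the indices are swapped by the trace.
  refine ⟨Matrix.of fun i j => (f (single j i 1) : ℂ) - f (single j i Complex.I) * Complex.I,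
    fun M => ?_⟩
  have hs : ∀ (i j : ι) (c : ℂ), f (single i j c) =
      c.re * f (single i j 1) + c.im * f (single i j Complex.I) := by
    intro i j c
    have : single i j c = c.re • single i j (1 : ℂ) + c.im • single i j Complex.I := by
      rw [smul_single, smul_single, ← single_add]
      simp [Complex.re_add_im]
    rw [this, map_add, map_smul, map_smul, smul_eq_mul, smul_eq_mul]
  have hf : f M = ∑ i, ∑ j, ((M i j).re * f (single i j 1) +
      (M i j).im * f (single i j Complex.I)) := by
    conv_lhs => rw [matrix_eq_sum_single M, map_sum]
    refine Finset.sum_congr rfl fun i _ => ?_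
    rw [map_sum]
    exact Finset.sum_congr rfl fun j _ => hs i j _
  rw [hf, trace, Finset.sum_comm]
  simp only [diag_apply, Matrix.mul_apply, of_apply, Complex.re_sum]
  refine Finset.sum_congr rfl fun i _ => Finset.sum_congr rfl fun j _ => ?_
  rw [sub_mul, Complex.sub_re, Complex.re_ofReal_mul, mul_assoc, Complex.re_ofReal_mul,
    Complex.I_mul_re]
  ring

theorem eq_zero_of_re_trace_mul_conjTranspose {D : Matrix ν ι ℂ}
    (h : (D * Dᴴ).trace.re = 0) : D = 0 := by
  ext i j
  have h1 : (D * Dᴴ).trace.re = ∑ i, ∑ j, ‖D i j‖ ^ 2 := by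
    simp only [trace, diag_apply, mul_apply, conjTranspose_apply, Complex.re_sum]
    refine Finset.sum_congr rfl fun i _ => Finset.sum_congr rfl fun j _ => ?_
    rw [← Complex.normSq_eq_norm_sq]
    simp [Complex.normSq_apply]
  rw [h1, Finset.sum_eq_zero_iff_of_nonneg fun i _ =>
    Finset.sum_nonneg fun j _ => sq_nonneg _] at h
  have h2 := h i (Finset.mem_univ i)
  rw [Finset.sum_eq_zero_iff_of_nonneg fun j _ => sq_nonneg _] at h2
  simpa using h2 j (Finset.mem_univ j)

/-- The matrices whose form becomes nonnegative after adding a storage term. -/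
def dissipative (E G : Matrix ν ι ℂ) : Set (Matrix ι ι ℂ) :=
  {M | ∃ P : Matrix ν ν ℂ, P.IsHermitian ∧
    ∀ v, 0 ≤ hermForm M v + hermForm P (E *ᵥ v) - hermForm P (G *ᵥ v)}

omit [Fintype ν] in
theorem isHermitian_real_smul {P : Matrix ν ν ℂ} (hP : P.IsHermitian) (t : ℝ) :
    (t • P).IsHermitian := by
  rw [IsHermitian, conjTranspose_smul, hP.eq, star_trivial]

theorem smul_mem_dissipative {E G : Matrix ν ι ℂ} {M : Matrix ι ι ℂ} (hM : M ∈ dissipative E G)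
    {t : ℝ} (ht : 0 ≤ t) : t • M ∈ dissipative E G := by
  obtain ⟨P, hP, h⟩ := hM
  refine ⟨t • P, isHermitian_real_smul hP t, fun v => ?_⟩
  simp only [hermForm_smul]
  have := mul_nonneg ht (h v)
  linarith

theorem add_mem_dissipative {E G : Matrix ν ι ℂ} {M N : Matrix ι ι ℂ}
    (hM : M ∈ dissipative E G) (hN : N ∈ dissipative E G) : M + N ∈ dissipative E G := by
  obtain ⟨P, hP, h⟩ := hM
  obtain ⟨R, hR, h'⟩ := hN
  refine ⟨P + R, hP.add hR, fun v => ?_⟩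
  simp only [hermForm_add]
  linarith [h v, h' v]

theorem convex_dissipative (E G : Matrix ν ι ℂ) : Convex ℝ (dissipative E G) :=
  fun _ hM _ hN _ _ hs ht _ =>
    add_mem_dissipative (smul_mem_dissipative hM hs) (smul_mem_dissipative hN ht)

theorem mem_dissipative_of_hermForm_nonneg {E G : Matrix ν ι ℂ} {M : Matrix ι ι ℂ}
    (h : ∀ v, 0 ≤ hermForm M v) : M ∈ dissipative E G :=
  ⟨0, isHermitian_zero, fun v => by simpa [hermForm] using h v⟩

/-- The storages of a convergent sequence may be unbounded. After rescaling, a limit with zero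
weight on `M₀` would be a nonzero storage excluded by `hEG`. -/
theorem isClosed_dissipative {E G : Matrix ν ι ℂ}
    (hEG : ∀ P : Matrix ν ν ℂ, P.IsHermitian →
      (∀ v, 0 ≤ hermForm P (E *ᵥ v) - hermForm P (G *ᵥ v)) → P = 0) :
    IsClosed (dissipative E G) := by
  have : SequentialSpace (Matrix ι ι ℂ) := inferInstanceAs (SequentialSpace (ι → ι → ℂ))
  refine IsSeqClosed.isClosed fun M M₀ hM hlim => ?_
  choose P hP h using hM
  -- Normalized so that `t k + ‖t k • P k‖ = 1`, a relation that survives in the limit and rules out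
  -- `s = 0`, `R = 0`.
  let t : ℕ → ℝ := fun k => (1 + ‖P k‖)⁻¹
  have ht0 : ∀ k, 0 < t k := fun k => by positivity
  have ht1 : ∀ k, t k + ‖t k • P k‖ = 1 := fun k => by
    rw [norm_smul, Real.norm_of_nonneg (ht0 k).le]
    simp only [t]
    field_simp
  obtain ⟨⟨s, R⟩, -, φ, hφ, hconv⟩ := tendsto_subseq_of_bounded
    (Metric.isBounded_closedBall (x := (0 : ℝ × Matrix ν ν ℂ)) (r := 1))
    (x := fun k => (t k, t k • P k)) (fun k => by
      rw [mem_closedBall_zero_iff, Prod.norm_def]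
      have := ht1 k
      have h2 := norm_nonneg (t k • P k)
      have h3 := ht0 k
      refine max_le ?_ ?_
      · rw [Real.norm_of_nonneg h3.le]; linarith
      · linarith)
  have hs := (continuous_fst.tendsto _).comp hconv
  have hR := (continuous_snd.tendsto _).comp hconv
  have hM := hlim.comp hφ.tendsto_atTop
  have hs0 : 0 ≤ s := ge_of_tendsto' hs fun k => (ht0 _).le
  have hsum : s + ‖R‖ = 1 :=
    tendsto_nhds_unique ((hs.add hR.norm).congr fun k => ht1 (φ k)) tendsto_const_nhds
  have hRH : R.IsHermitian := by
    have hc : IsClosed {R : Matrix ν ν ℂ | Rᴴ = R} :=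
      isClosed_eq (continuous_id.matrix_conjTranspose) continuous_id
    exact hc.mem_of_tendsto hR (Filter.Eventually.of_forall fun k =>
      isHermitian_real_smul (hP (φ k)) _)
  have hlimform : ∀ v, 0 ≤ s * hermForm M₀ v + hermForm R (E *ᵥ v) - hermForm R (G *ᵥ v) := by
    intro v
    have h1 := ((hs.mul (((continuous_hermForm v).tendsto M₀).comp hM)).add
      (((continuous_hermForm (E *ᵥ v)).tendsto R).comp hR)).sub
      (((continuous_hermForm (G *ᵥ v)).tendsto R).comp hR)
    refine ge_of_tendsto' h1 fun k => ?_
    have h2 := mul_nonneg (ht0 (φ k)).le (h (φ k) v)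
    simp only [Function.comp_apply, hermForm_smul]
    linarith
  rcases hs0.eq_or_lt with rfl | hpos
  · have hR0 : R = 0 := hEG R hRH fun v => by simpa using hlimform v
    simp [hR0] at hsum
  · refine ⟨s⁻¹ • R, isHermitian_real_smul hRH _, fun v => ?_⟩
    have := mul_nonneg (inv_nonneg.mpr hs0) (hlimform v)
    simp only [hermForm_smul]
    have h3 : s⁻¹ * (s * hermForm M₀ v) = hermForm M₀ v := by field_simp
    linarith

theorem mem_dissipative_of_nonneg_on_unit_circle {E G : Matrix ν ι ℂ}
    (hEG : ∀ P : Matrix ν ν ℂ, P.IsHermitian →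
      (∀ v, 0 ≤ hermForm P (E *ᵥ v) - hermForm P (G *ᵥ v)) → P = 0) {Q : Matrix ι ι ℂ}
    (hQ : ∀ z : ℂ, ‖z‖ = 1 → ∀ v, G *ᵥ v = z • (E *ᵥ v) → 0 ≤ hermForm Q v) :
    Q ∈ dissipative E G := by
  have : LocallyConvexSpace ℝ (Matrix ι ι ℂ) :=
    inferInstanceAs (LocallyConvexSpace ℝ (ι → ι → ℂ))
  by_contra hne
  obtain ⟨f, u, hfu, hu⟩ := geometric_hahn_banach_point_closed (convex_dissipative E G)
    (isClosed_dissipative hEG) hne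
  have hu0 : u < 0 := by
    have := hu 0 (mem_dissipative_of_hermForm_nonneg fun v => by simp [hermForm])
    simpa using this
  have hnonneg : ∀ M ∈ dissipative E G, 0 ≤ f M := by
    intro M hM
    by_contra! hlt
    -- This multiple of `M` is scaled to have `f`-value exactly `u`.
    have h1 := hu _ (smul_mem_dissipative hM (div_nonneg_of_nonpos hu0.le hlt.le))
    rw [map_smul, smul_eq_mul, div_mul_cancel₀ _ hlt.ne] at h1
    exact lt_irrefl _ h1
  have hzero : ∀ M, M ∈ dissipative E G → -M ∈ dissipative E G → f M = 0 := by
    intro M h1 h2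
    have h3 := hnonneg _ h2
    rw [map_neg] at h3
    linarith [hnonneg _ h1]
  obtain ⟨W, hW⟩ := exists_re_trace_mul_eq f.toLinearMap
  replace hW : ∀ M, f M = (W * M).trace.re := hW
  -- The real form of `Mᴴ - M` vanishes, so this matrix and its negative both lie in the cone.
  have hskew : ∀ M, f Mᴴ = f M := by
    intro M
    rw [← sub_eq_zero, ← map_sub]
    refine hzero _ (mem_dissipative_of_hermForm_nonneg fun v => ?_)
      (mem_dissipative_of_hermForm_nonneg fun v => ?_) <;>
    simp [hermForm_sub, hermForm_conjTranspose]
  have hWH : W.IsHermitian := by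
    have key : ∀ M, ((Wᴴ - W) * M).trace.re = 0 := by
      intro M
      have h1 := hskew M
      rw [hW, hW] at h1
      have h2 : (Wᴴ * M).trace.re = (W * Mᴴ).trace.re := by
        rw [trace_mul_comm, ← conjTranspose_conjTranspose (M * Wᴴ), conjTranspose_mul,
          conjTranspose_conjTranspose, trace_conjTranspose]
        simp
      rw [Matrix.sub_mul, trace_sub, Complex.sub_re, h2, h1, sub_self]
    exact sub_eq_zero.mp (eq_zero_of_re_trace_mul_conjTranspose (key _))
  have hWpsd : W.PosSemidef := by
    refine .of_dotProduct_mulVec_nonneg hWH fun v => ?_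
    rw [← coe_hermForm hWH, Complex.zero_le_real, hermForm_eq_trace, ← hW]
    refine hnonneg _ (mem_dissipative_of_hermForm_nonneg fun w => ?_)
    have := (posSemidef_vecMulVec_self_star v).dotProduct_mulVec_nonneg w
    exact (Complex.le_def.mp this).1
  have hstat : E * W * Eᴴ = G * W * Gᴴ := by
    set D := E * W * Eᴴ - G * W * Gᴴ with hD
    have hDH : D.IsHermitian :=
      (isHermitian_mul_mul_conjTranspose _ hWH).sub (isHermitian_mul_mul_conjTranspose _ hWH)
    -- The storages `-D` and `D` put this matrix and its negative in the cone. Since `D` is the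
    -- defect itself, the value of `f` is `Re tr(D D')`.
    have h0 : f (Eᴴ * D * E - Gᴴ * D * G) = 0 := by
      refine hzero _ ⟨-D, hDH.neg, fun v => ?_⟩ ⟨D, hDH, fun v => ?_⟩ <;>
      · simp only [hermForm_neg, hermForm_sub, hermForm_conjTranspose_mul_mul]
        linarith
    have ht : ∀ F : Matrix ν ι ℂ, (W * (Fᴴ * D * F)).trace = (F * W * Fᴴ * D).trace := by
      intro F
      rw [← Matrix.mul_assoc, trace_mul_comm]
      simp only [Matrix.mul_assoc]
    rw [hW, Matrix.mul_sub, trace_sub, ht, ht, ← trace_sub, ← Matrix.sub_mul, ← hD] at h0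
    refine sub_eq_zero.mp (eq_zero_of_re_trace_mul_conjTranspose (D := D) ?_)
    rw [hDH.eq, h0]
  obtain ⟨N, v, hv, hz⟩ := exists_sum_dyads E G hWpsd hstat
  have hfQ : 0 ≤ f Q := by
    rw [hW, trace_mul_comm, hv, Matrix.mul_sum, trace_sum, Complex.re_sum]
    refine Finset.sum_nonneg fun k _ => ?_
    rw [← hermForm_eq_trace]
    obtain ⟨z, hz1, hz2⟩ := hz k
    exact hQ z hz1 _ hz2
  linarith

end Separation

end KYP

/-! ### Application to controllable pairs, and real storages -/

namespace KYP

variable {n m : ℕ}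

theorem Controllable.exists_eq {A : Matrix (Fin n) (Fin n) ℂ} {B : Matrix (Fin n) (Fin m) ℂ}
    (h : Controllable A B) (l : ℂ) (y : Fin n → ℂ) :
    ∃ (x : Fin n → ℂ) (u : Fin m → ℂ), l • x - A *ᵥ x + B *ᵥ u = y := by
  obtain ⟨M, hM⟩ := h l
  refine ⟨(M *ᵥ y) ∘ Sum.inl, (M *ᵥ y) ∘ Sum.inr, ?_⟩
  have h1 := congrArg (· *ᵥ y) hM
  simp only [one_mulVec, ← mulVec_mulVec] at h1
  rw [← Sum.elim_comp_inl_inr (M *ᵥ y), fromCols_mulVec_sumElim, sub_mulVec, smul_mulVec,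
    one_mulVec] at h1
  exact h1

theorem Controllable.eq_zero_of_antitone {A : Matrix (Fin n) (Fin n) ℂ}
    {B : Matrix (Fin n) (Fin m) ℂ} (h : Controllable A B) {P : Matrix (Fin n) (Fin n) ℂ}
    (hP : P.IsHermitian)
    (hanti : ∀ x u, hermForm P (A *ᵥ x + B *ᵥ u) ≤ hermForm P x) : P = 0 :=
  eq_zero_of_hermForm_eq_zero hP <|
    form_eq_zero_of_antitone A.mulVecLin B.mulVecLin h.exists_eq (hermForm P)
      (by simp [hermForm]) hanti

theorem sigmaP_eq (A : Matrix (Fin n) (Fin n) ℂ) (B : Matrix (Fin n) (Fin m) ℂ)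
    (Q : Matrix (Fin n ⊕ Fin m) (Fin n ⊕ Fin m) ℂ) (P : Matrix (Fin n) (Fin n) ℂ)
    (x : Fin n → ℂ) (u : Fin m → ℂ) :
    sigmaP A B Q P x u = hermForm Q (Sum.elim x u) +
      hermForm P (fromCols 1 (0 : Matrix (Fin n) (Fin m) ℂ) *ᵥ Sum.elim x u) -
      hermForm P (fromCols A B *ᵥ Sum.elim x u) := by
  rw [fromCols_mulVec_sumElim, fromCols_mulVec_sumElim, one_mulVec, zero_mulVec, add_zero]
  rfl

theorem exists_storage {A : Matrix (Fin n) (Fin n) ℂ} {B : Matrix (Fin n) (Fin m) ℂ}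
    (hAB : Controllable A B) {Q : Matrix (Fin n ⊕ Fin m) (Fin n ⊕ Fin m) ℂ}
    (h : ∀ z : ℂ, ‖z‖ = 1 → ∀ p ∈ subspaceL A B z, 0 ≤ sigma Q p.1 p.2) :
    ∃ P : Matrix (Fin n) (Fin n) ℂ, P.IsHermitian ∧ ∀ x u, 0 ≤ sigmaP A B Q P x u := by
  have hsplit : ∀ v : Fin n ⊕ Fin m → ℂ, Sum.elim (v ∘ Sum.inl) (v ∘ Sum.inr) = v :=
    Sum.elim_comp_inl_inr
  obtain ⟨P, hP, hPQ⟩ := mem_dissipative_of_nonneg_on_unit_circle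
    (E := fromCols 1 (0 : Matrix (Fin n) (Fin m) ℂ)) (G := fromCols A B) (Q := Q)
    (fun P hP hanti => hAB.eq_zero_of_antitone hP fun x u => by
      have h1 := hanti (Sum.elim x u)
      rw [fromCols_mulVec_sumElim, fromCols_mulVec_sumElim, one_mulVec, zero_mulVec,
        add_zero] at h1
      linarith)
    (fun z hz v hv => by
      rw [← hsplit v] at hv ⊢
      rw [fromCols_mulVec_sumElim, fromCols_mulVec_sumElim, one_mulVec, zero_mulVec,
        add_zero] at hv
      exact h z hz (v ∘ Sum.inl, v ∘ Sum.inr) hv.symm)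
  exact ⟨P, hP, fun x u => (sigmaP_eq A B Q P x u).symm ▸ hPQ (Sum.elim x u)⟩

theorem sigma_nonneg_of_storage {A : Matrix (Fin n) (Fin n) ℂ} {B : Matrix (Fin n) (Fin m) ℂ}
    {Q : Matrix (Fin n ⊕ Fin m) (Fin n ⊕ Fin m) ℂ} {P : Matrix (Fin n) (Fin n) ℂ}
    (hP : ∀ x u, 0 ≤ sigmaP A B Q P x u) {z : ℂ} (hz : ‖z‖ = 1) {p : (Fin n → ℂ) × (Fin m → ℂ)}
    (hp : p ∈ subspaceL A B z) : 0 ≤ sigma Q p.1 p.2 := by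
  have h1 := hP p.1 p.2
  have h2 : z • p.1 = A *ᵥ p.1 + B *ᵥ p.2 := hp
  rw [sigmaP, ← h2, hermForm_smul_vec, hz] at h1
  linarith

theorem IsRealMatrix.map_star {ι κ : Type*} {M : Matrix ι κ ℂ} (hM : IsRealMatrix M) :
    M.map star = M := by
  ext i j
  exact Complex.conj_eq_iff_im.mpr (hM i j)

theorem star_mulVec_map_star {ι κ : Type*} [Fintype κ] (M : Matrix ι κ ℂ) (v : κ → ℂ) :
    star (M *ᵥ v) = M.map star *ᵥ star v := by
  ext i
  simp [mulVec, dotProduct]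

theorem hermForm_map_star {ι : Type*} [Fintype ι] (M : Matrix ι ι ℂ) (v : ι → ℂ) :
    hermForm (M.map star) v = hermForm M (star v) := by
  have h : star v ⬝ᵥ (M.map star *ᵥ v) = star (star (star v) ⬝ᵥ (M *ᵥ star v)) := by
    rw [star_star, star_dotProduct, ← star_star v, ← star_mulVec_map_star, star_star, star_star,
      dotProduct_comm]
  rw [hermForm, h]
  simp [hermForm]

theorem sigmaP_map_star {A : Matrix (Fin n) (Fin n) ℂ} {B : Matrix (Fin n) (Fin m) ℂ}
    {Q : Matrix (Fin n ⊕ Fin m) (Fin n ⊕ Fin m) ℂ} (hA : IsRealMatrix A) (hB : IsRealMatrix B)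
    (hQ : IsRealMatrix Q) (P : Matrix (Fin n) (Fin n) ℂ) (x : Fin n → ℂ) (u : Fin m → ℂ) :
    sigmaP A B Q (P.map star) x u = sigmaP A B Q P (star x) (star u) := by
  have h1 : star (Sum.elim x u) = Sum.elim (star x) (star u) := by
    ext (i | i) <;> rfl
  rw [sigmaP, sigmaP, sigma, sigma, hermForm_map_star, hermForm_map_star, star_add,
    star_mulVec_map_star, star_mulVec_map_star, hA.map_star, hB.map_star, ← h1,
    ← hermForm_map_star Q, hQ.map_star]

/-- For real data, conjugating `P` entrywise amounts to conjugating `x` and `u`, so the conjugate is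
again a storage; so is the average, by linearity in `P`. -/
theorem exists_real_storage {A : Matrix (Fin n) (Fin n) ℂ} {B : Matrix (Fin n) (Fin m) ℂ}
    {Q : Matrix (Fin n ⊕ Fin m) (Fin n ⊕ Fin m) ℂ} (hA : IsRealMatrix A) (hB : IsRealMatrix B)
    (hQ : IsRealMatrix Q) {P : Matrix (Fin n) (Fin n) ℂ} (hP : P.IsHermitian)
    (h : ∀ x u, 0 ≤ sigmaP A B Q P x u) :
    ∃ R : Matrix (Fin n) (Fin n) ℂ, R.IsHermitian ∧ IsRealMatrix R ∧
      ∀ x u, 0 ≤ sigmaP A B Q R x u := by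
  refine ⟨(2⁻¹ : ℝ) • (P + P.map star), ?_, fun i j => by simp, fun x u => ?_⟩
  · refine isHermitian_real_smul (hP.add ?_) _
    rw [IsHermitian, ← conjTranspose_map star fun _ => rfl, hP.eq]
  · have h1 := h x u
    have h2 := sigmaP_map_star hA hB hQ P x u ▸ h (star x) (star u)
    simp only [sigmaP, hermForm_smul, hermForm_add] at h1 h2 ⊢
    linarith

end KYP

theorem mainTheorem3 (n m : ℕ) (A : Matrix (Fin n) (Fin n) ℂ) (B : Matrix (Fin n) (Fin m) ℂ)
    (hAB : KYP.Controllable A B)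
    (Q : Matrix (Fin n ⊕ Fin m) (Fin n ⊕ Fin m) ℂ) (hQ : Q.IsHermitian) :
    ((∃ P : Matrix (Fin n) (Fin n) ℂ, P.IsHermitian ∧
        ∀ (x : Fin n → ℂ) (u : Fin m → ℂ), 0 ≤ KYP.sigmaP A B Q P x u) ↔
      (∀ z : ℂ, ‖z‖ = 1 → ∀ p ∈ KYP.subspaceL A B z, 0 ≤ KYP.sigma Q p.1 p.2)) ∧
    (KYP.IsRealMatrix A → KYP.IsRealMatrix B → KYP.IsRealMatrix Q →
      (∀ z : ℂ, ‖z‖ = 1 → ∀ p ∈ KYP.subspaceL A B z, 0 ≤ KYP.sigma Q p.1 p.2) →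
      ∃ P : Matrix (Fin n) (Fin n) ℂ, P.IsHermitian ∧ KYP.IsRealMatrix P ∧
        ∀ (x : Fin n → ℂ) (u : Fin m → ℂ), 0 ≤ KYP.sigmaP A B Q P x u) := by
  refine ⟨⟨fun ⟨P, _, hP⟩ z hz p hp => KYP.sigma_nonneg_of_storage hP hz hp,
    KYP.exists_storage hAB⟩, fun hA hB hQr h => ?_⟩
  obtain ⟨P, hP, hPQ⟩ := KYP.exists_storage hAB h
  exact KYP.exists_real_storage hA hB hQr hP hPQ
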